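/- For $n\ge 0$ let $LC_g(\mathbb{R}^n)$ be the class of functions $f:\mathbb{R}^n\to[0,1]$ that are upper semicontinuous and log-concave, satisfy $f(0)=1=\max f$, and have $0<\int f<\infty$. Let $g_0(x)=e^{-|x|^2/2}$ on $\mathbb{R}^n$. For functions $f,h:\mathbb{R}^n\to[0,1]$ put $(f\star h)(x)=\sup_z f(z)h(x-z)$, and for $f=e^{-\varphi}$ (with $\varphi=+\infty$ where $f=0$) put $f^*=e^{-\mathcal{L}\varphi}$, where $\mathcal{L}\varphi(y)=\sup_x(\langle x,y\rangle-\varphi(x))$. For measurable $f,g:\mathbb{R}^n\to[0,\infty)$ let $$N(f,g)=\inf\Big\{\mu(\mathbb{R}^n):\ \int g(x-t)\,d\mu(t)\ge f(x)\ \text{ for all } x\in\mathbb{R}^n\Big\},$$ the infimum being over all non-negative Borel measures $\mu$ on $\mathbb{R}^n$. Integrals are with respect to Lebesgue measure and may be $+\infty$. Let $f\in LC_g(\mathbb{R}^n)$ and $C>0$. We say that $f$ is in *volume-$M$-position with constant $C$* if $\int f=(2\pi)^{n/2}$ and for every $h\in LC_g(\mathbb{R}^n)$ $$\frac1{C^n}\int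 g_0\star h\le\int f\star h\le C^n\int g_0\star h\quad\text{and}\quad \frac1{C^n}\int g_0\star h\le\int f^*\star h\le C^n\int g_0\star h .$$ We say that $f$ is in *covering-$M$-position with constant $C$* if $\int f=(2\pi)^{n/2}$ and $$N(f,g_0),\ N(g_0,f),\ N(f^*,g_0),\ N(g_0,f^*)\ \le\ C^n .$$ **Theorem.** For every $C>0$ there exists $C_1=C_1(C)>0$, depending only on $C$ (in particular not on the dimension), such that for every $n$ and every $f\in LC_g(\mathbb{R}^n)$: if $f$ is in covering-$M$-position with constant $C$, then $f$ is in volume-$M$-position with constant $C_1$; and if $f$ is in volume-$M$-position with constant $C$, then $f$ is in covering-$M$-position with constant $C_1$. -/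

import Mathlib

open MeasureTheory
open scoped ENNReal

namespace FunctionalCovering

/-- Euclidean space `ℝⁿ`. -/
abbrev Euc (n : ℕ) : Type := EuclideanSpace ℝ (Fin n)

/-- The `h`-covering number `N(f, g, h)`: the infimum of `∫ h dμ` over all non-negative Borel
measures `μ` with `μ * g ≥ f` pointwise. -/
noncomputable def coveringNumberW {n : ℕ} (f g h : Euc n → ℝ≥0∞) : ℝ≥0∞ :=
  ⨅ (μ : Measure (Euc n)) (_ : ∀ x, f x ≤ ∫⁻ t, g (x - t) ∂μ), ∫⁻ t, h t ∂μ

/-- The functional covering number `N(f, g) = N(f, g, 1)`. -/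
noncomputable def coveringNumber {n : ℕ} (f g : Euc n → ℝ≥0∞) : ℝ≥0∞ :=
  coveringNumberW f g (fun _ => 1)

/-- The sup-convolution `(f ⋆ g)(x) = sup_z f(z) g(x - z)`. -/
noncomputable def supConv {n : ℕ} (f g : Euc n → ℝ≥0∞) : Euc n → ℝ≥0∞ :=
  fun x => ⨆ z, f z * g (x - z)

/-- The Legendre transform `(𝓛φ)(y) = sup_x (⟨x, y⟩ - φ(x))`. -/
noncomputable def legendre {n : ℕ} (φ : Euc n → EReal) : Euc n → EReal :=
  fun y => ⨆ x, ((inner ℝ x y : ℝ) : EReal) - φ x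

/-- The log-Legendre dual `f* = exp(-𝓛φ)` of `f = exp(-φ)`; here `φ = -log f` is `+∞` where
`f = 0`. -/
noncomputable def logDual {n : ℕ} (f : Euc n → ℝ≥0∞) : Euc n → ℝ≥0∞ :=
  fun y => EReal.exp (-(legendre (fun x => -ENNReal.log (f x)) y))

/-- The class `LC_g(ℝⁿ)` of geometric log-concave functions: upper semicontinuous log-concave
functions with `max f = f(0) = 1` and finite, positive integral. -/
structure IsGeomLogConcave {n : ℕ} (f : Euc n → ℝ≥0∞) : Prop where
  usc : UpperSemicontinuous f
  logConcave : ∀ x y : Euc n, ∀ a b : ℝ, 0 ≤ a → 0 ≤ b → a + b = 1 →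
    f x ^ a * f y ^ b ≤ f (a • x + b • y)
  le_one : ∀ x, f x ≤ 1
  map_zero : f 0 = 1
  lintegral_pos : 0 < ∫⁻ x, f x
  lintegral_lt_top : ∫⁻ x, f x < ∞

/-- The Gaussian `g₀(x) = exp(-|x|² / 2)`. -/
noncomputable def gaussian (n : ℕ) : Euc n → ℝ≥0∞ :=
  fun x => ENNReal.ofReal (Real.exp (-(1 / 2) * ‖x‖ ^ 2))

/-- `f` is in volume-`M`-position with constant `C`. -/
structure VolumeMPosition {n : ℕ} (f : Euc n → ℝ≥0∞) (C : ℝ) : Prop where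
  geom : IsGeomLogConcave f
  lintegral_eq : ∫⁻ x, f x = ENNReal.ofReal ((2 * Real.pi) ^ ((n : ℝ) / 2))
  lower : ∀ h : Euc n → ℝ≥0∞, IsGeomLogConcave h →
    ENNReal.ofReal (1 / C ^ n) * ∫⁻ x, supConv (gaussian n) h x ≤ ∫⁻ x, supConv f h x
  upper : ∀ h : Euc n → ℝ≥0∞, IsGeomLogConcave h →
    ∫⁻ x, supConv f h x ≤ ENNReal.ofReal (C ^ n) * ∫⁻ x, supConv (gaussian n) h x
  dual_lower : ∀ h : Euc n → ℝ≥0∞, IsGeomLogConcave h →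
    ENNReal.ofReal (1 / C ^ n) * ∫⁻ x, supConv (gaussian n) h x ≤ ∫⁻ x, supConv (logDual f) h x
  dual_upper : ∀ h : Euc n → ℝ≥0∞, IsGeomLogConcave h →
    ∫⁻ x, supConv (logDual f) h x ≤ ENNReal.ofReal (C ^ n) * ∫⁻ x, supConv (gaussian n) h x

/-- `f` is in covering-`M`-position with constant `C`. -/
structure CoveringMPosition {n : ℕ} (f : Euc n → ℝ≥0∞) (C : ℝ) : Prop where
  geom : IsGeomLogConcave f
  lintegral_eq : ∫⁻ x, f x = ENNReal.ofReal ((2 * Real.pi) ^ ((n : ℝ) / 2))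
  cover_by_gaussian : coveringNumber f (gaussian n) ≤ ENNReal.ofReal (C ^ n)
  cover_gaussian : coveringNumber (gaussian n) f ≤ ENNReal.ofReal (C ^ n)
  dual_cover_by_gaussian : coveringNumber (logDual f) (gaussian n) ≤ ENNReal.ofReal (C ^ n)
  dual_cover_gaussian : coveringNumber (gaussian n) (logDual f) ≤ ENNReal.ofReal (C ^ n)

end FunctionalCovering

namespace FunctionalCovering

open Filter Topology

/-! ### Log-concave functions and measurability of sup-convolutions -/

/-! Covering numbers and integrals of sup-convolutions control each other. If `μ * g ≥ f`, then `f ⋆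
h ≤ μ * (g ⋆ h)` pointwise, and Tonelli gives `∫ f ⋆ h ≤ N(f, g) ∫ g ⋆ h`
(`lintegral_supConv_le_mul`); this is covering ⇒ volume.

Conversely, the measure with density proportional to `f ⋆ h` is a cover, so `N(f, g) ≤ ∫ f ⋆ h / ∫
g(s) h(-s) ds` (`coveringNumber_le_lintegral_supConv`). To cover `u` by `g₀`, take `h = g₀`: the
denominator `∫ g₀²` is within `2ⁿ` of `∫ g₀ ⋆ g₀`. To cover `g₀` by `u`, take `h = u(-·)`: the
numerator becomes `∫ u ⋆ g₀`, and the denominator `∫ u²` is at least `2⁻ⁿ ∫ u` by log-concavity.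

It remains to bound `∫ u` below. For `u = f` this is the normalization; for `u = f*` it follows from
the dual lower bound by letting the test function shrink to a point. -/

/-- Log-concavity of an extended nonnegative function. -/
def IsLogConcave {n : ℕ} (f : Euc n → ℝ≥0∞) : Prop :=
  ∀ x y : Euc n, ∀ a b : ℝ, 0 ≤ a → 0 ≤ b → a + b = 1 →
    f x ^ a * f y ^ b ≤ f (a • x + b • y)

/-- A function whose strict superlevel sets are convex is almost everywhere measurable. -/
theorem aemeasurable_of_convex_superlevel {n : ℕ} {u : Euc n → ℝ≥0∞}
    (hu : ∀ a, Convex ℝ {x | a < u x}) : AEMeasurable u volume := by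
  have h : @Measurable (NullMeasurableSpace (Euc n) volume) _ _ _ u :=
    measurable_of_Ioi fun a => (hu a).nullMeasurableSet volume
  have h' : NullMeasurable u (volume : Measure (Euc n)) := fun s hs => h hs
  exact h'.aemeasurable

/-- Convex combinations of witnesses `z`, `w` are again witnesses. The point is measurability: an
uncountable supremum need not be measurable, but convex sets are null-measurable. -/
theorem IsLogConcave.convex_superlevel_supConv {n : ℕ} {f h : Euc n → ℝ≥0∞}
    (hf : IsLogConcave f) (hh : IsLogConcave h) (a : ℝ≥0∞) :
    Convex ℝ {x | a < supConv f h x} := by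
  intro x hx y hy s t hs ht hst
  simp only [Set.mem_ofPred_eq, supConv, lt_iSup_iff] at hx hy ⊢
  obtain ⟨z, hz⟩ := hx
  obtain ⟨w, hw⟩ := hy
  refine ⟨s • z + t • w, ?_⟩
  set m := min (f z * h (x - z)) (f w * h (y - w))
  have hsub : s • x + t • y - (s • z + t • w) = s • (x - z) + t • (y - w) := by
    simp only [smul_sub]; abel
  calc a < m := lt_min hz hw
    _ = m ^ s * m ^ t := by rw [← ENNReal.rpow_add_of_nonneg _ _ hs ht, hst, ENNReal.rpow_one]
    _ ≤ (f z * h (x - z)) ^ s * (f w * h (y - w)) ^ t := by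
        gcongr
        · exact min_le_left _ _
        · exact min_le_right _ _
    _ = (f z ^ s * f w ^ t) * (h (x - z) ^ s * h (y - w) ^ t) := by
        rw [ENNReal.mul_rpow_of_nonneg _ _ hs, ENNReal.mul_rpow_of_nonneg _ _ ht]; ring
    _ ≤ f (s • z + t • w) * h (s • (x - z) + t • (y - w)) := by
        gcongr
        · exact hf _ _ _ _ hs ht hst
        · exact hh _ _ _ _ hs ht hst
    _ = _ := by rw [hsub]

theorem IsLogConcave.aemeasurable_supConv {n : ℕ} {f h : Euc n → ℝ≥0∞}
    (hf : IsLogConcave f) (hh : IsLogConcave h) : AEMeasurable (supConv f h) volume :=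
  aemeasurable_of_convex_superlevel (hf.convex_superlevel_supConv hh)

theorem IsLogConcave.comp_neg {n : ℕ} {f : Euc n → ℝ≥0∞} (hf : IsLogConcave f) :
    IsLogConcave fun x => f (-x) := by
  intro x y a b ha hb hab
  have := hf (-x) (-y) a b ha hb hab
  rwa [show a • (-x) + b • (-y) = -(a • x + b • y) by simp only [smul_neg]; abel] at this

/-- An almost everywhere measurable function has a measurable majorant with the same integral. -/
theorem exists_measurable_ge_lintegral_eq {α : Type*} [MeasurableSpace α] {μ : Measure α}
    {u : α → ℝ≥0∞} (hu : AEMeasurable u μ) :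
    ∃ v : α → ℝ≥0∞, Measurable v ∧ u ≤ v ∧ ∫⁻ x, v x ∂μ = ∫⁻ x, u x ∂μ := by
  classical
  set s := toMeasurable μ {x | u x ≠ hu.mk u x}
  have hs0 : μ s = 0 := by
    rw [measure_toMeasurable]
    exact hu.ae_eq_mk
  have hs : MeasurableSet s := measurableSet_toMeasurable _ _
  refine ⟨s.piecewise (fun _ => ∞) (hu.mk u), Measurable.piecewise hs measurable_const
    hu.measurable_mk, ?_, ?_⟩
  · intro x
    by_cases hx : x ∈ s
    · simp [hx]
    · have : u x = hu.mk u x := by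
        by_contra h
        exact hx (subset_toMeasurable _ _ h)
      simp [hx, this]
  · refine lintegral_congr_ae ?_
    have : ∀ᵐ x ∂μ, x ∉ s := measure_eq_zero_iff_ae_notMem.1 hs0
    filter_upwards [this, hu.ae_eq_mk] with x hx hux
    simp [hx, hux]

theorem le_supConv_left {n : ℕ} {f h : Euc n → ℝ≥0∞} (h0 : h 0 = 1) (x : Euc n) :
    f x ≤ supConv f h x := by
  refine le_iSup_of_le x ?_
  simp [h0]

/-! ### Covering numbers and volumes -/

/-- If `μ * g ≥ f`, then `∫ f ⋆ h ≤ μ(ℝⁿ) ∫ g ⋆ h`. -/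
theorem lintegral_supConv_le_of_cover {n : ℕ} {f g h : Euc n → ℝ≥0∞} (hg : IsLogConcave g)
    (hh : IsLogConcave h) (hh1 : ∀ x, h x ≤ 1) {μ : Measure (Euc n)} [IsFiniteMeasure μ]
    (hμ : ∀ x, f x ≤ ∫⁻ t, g (x - t) ∂μ) :
    ∫⁻ x, supConv f h x ≤ μ Set.univ * ∫⁻ x, supConv g h x := by
  -- An almost everywhere equal version would not do: `μ` may charge Lebesgue-null sets, so the
  -- majorant must hold at every point.
  obtain ⟨v, hv, hle, hint⟩ := exists_measurable_ge_lintegral_eq (hg.aemeasurable_supConv hh)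
  have key : ∀ x, supConv f h x ≤ ∫⁻ t, v (x - t) ∂μ := by
    intro x
    refine iSup_le fun z => ?_
    calc f z * h (x - z) ≤ (∫⁻ t, g (z - t) ∂μ) * h (x - z) := by gcongr; exact hμ z
      _ = ∫⁻ t, g (z - t) * h (x - z) ∂μ :=
          (lintegral_mul_const' _ _ ((hh1 _).trans_lt ENNReal.one_lt_top).ne).symm
      _ ≤ ∫⁻ t, v (x - t) ∂μ := by
          refine lintegral_mono fun t => le_trans ?_ (hle (x - t))
          refine le_iSup_of_le (z - t) ?_
          rw [sub_sub_sub_cancel_right]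
  calc ∫⁻ x, supConv f h x ≤ ∫⁻ x, ∫⁻ t, v (x - t) ∂μ := lintegral_mono key
    _ = ∫⁻ t, (∫⁻ x, v (x - t)) ∂μ :=
        lintegral_lintegral_swap (f := fun x t => v (x - t)) (hv.comp measurable_sub).aemeasurable
    _ = ∫⁻ _, (∫⁻ x, supConv g h x) ∂μ := by
        simp_rw [lintegral_sub_right_eq_self v, hint]
    _ = _ := by rw [lintegral_const, mul_comm]

/-- The infimum defining `N(f, g)` need not be attained, so a cover of mass below `b` is used for
each finite `b > c`, and then `b ↓ c`. -/
theorem lintegral_supConv_le_mul {n : ℕ} {f g h : Euc n → ℝ≥0∞} (hg : IsLogConcave g)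
    (hh : IsLogConcave h) (hh1 : ∀ x, h x ≤ 1) {c : ℝ≥0∞} (hc0 : c ≠ 0) (hc : c ≠ ∞)
    (hN : coveringNumber f g ≤ c) :
    ∫⁻ x, supConv f h x ≤ c * ∫⁻ x, supConv g h x := by
  by_cases htop : ∫⁻ x, supConv g h x = ∞
  · rw [htop, ENNReal.mul_top hc0]
    exact le_top
  have hlim : Tendsto (fun b : ℝ≥0∞ => b * ∫⁻ x, supConv g h x) (𝓝[>] c)
      (𝓝 (c * ∫⁻ x, supConv g h x)) :=
    (ENNReal.Tendsto.mul_const tendsto_id (Or.inr htop)).mono_left nhdsWithin_le_nhds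
  have : (𝓝[>] c).NeBot := nhdsGT_neBot_of_exists_gt ⟨∞, hc.lt_top⟩
  refine ge_of_tendsto hlim ?_
  filter_upwards [Ioo_mem_nhdsGT hc.lt_top] with b hb
  have hlt : coveringNumber f g < b := hN.trans_lt hb.1
  simp only [coveringNumber, coveringNumberW, iInf_lt_iff, lintegral_one] at hlt
  obtain ⟨μ, hμ, hμb⟩ := hlt
  have : IsFiniteMeasure μ := ⟨hμb.trans hb.2⟩
  exact (lintegral_supConv_le_of_cover hg hh hh1 hμ).trans (by gcongr)

/-- The volume bound for covering numbers: `N(f, g) ≤ ∫ f ⋆ h / ∫ g(s) h(-s) ds`. -/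
theorem coveringNumber_le_lintegral_supConv {n : ℕ} {f g h : Euc n → ℝ≥0∞}
    (hf : IsLogConcave f) (hf1 : ∀ x, f x ≤ 1) (hh : IsLogConcave h) (hg : Measurable g)
    {c : ℝ≥0∞} (hc0 : c ≠ 0) (hc : c ≠ ∞) (hle : c ≤ ∫⁻ s, g s * h (-s)) :
    coveringNumber f g ≤ c⁻¹ * ∫⁻ x, supConv f h x := by
  obtain ⟨v, hv, hfv, hint⟩ := exists_measurable_ge_lintegral_eq (hf.aemeasurable_supConv hh)
  have hv' : Measurable fun t => c⁻¹ * v t := hv.const_mul _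
  -- Since `v(t) ≥ f(x) h(t - x)`, this density convolved with `g` is at least `c⁻¹ f(x) ∫ g(x - t)
  -- h(t - x) dt ≥ f(x)`.
  refine (iInf₂_le (volume.withDensity fun t => c⁻¹ * v t) ?_).trans ?_
  · intro x
    have hgx : Measurable fun t => g (x - t) := hg.comp (measurable_const.sub measurable_id)
    rw [lintegral_withDensity_eq_lintegral_mul _ hv' hgx]
    have hfx : f x ≠ ∞ := ((hf1 x).trans_lt ENNReal.one_lt_top).ne
    calc f x = c⁻¹ * f x * c := by
          rw [mul_right_comm, ENNReal.inv_mul_cancel hc0 hc, one_mul]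
      _ ≤ c⁻¹ * f x * ∫⁻ s, g s * h (-s) := by gcongr
      _ = c⁻¹ * f x * ∫⁻ t, g (x - t) * h (-(x - t)) := by
          rw [lintegral_sub_left_eq_self (fun s => g s * h (-s)) x]
      _ = ∫⁻ t, c⁻¹ * f x * (g (x - t) * h (-(x - t))) :=
          (lintegral_const_mul' _ _ (ENNReal.mul_ne_top (ENNReal.inv_ne_top.2 hc0) hfx)).symm
      _ ≤ ∫⁻ t, c⁻¹ * v t * g (x - t) := by
          refine lintegral_mono fun t => ?_
          have : f x * h (t - x) ≤ v t := le_trans (le_iSup_of_le x le_rfl) (hfv t)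
          calc c⁻¹ * f x * (g (x - t) * h (-(x - t)))
              = c⁻¹ * (f x * h (t - x)) * g (x - t) := by rw [neg_sub]; ring
            _ ≤ _ := by gcongr
  · rw [lintegral_one, withDensity_apply _ MeasurableSet.univ, Measure.restrict_univ,
      lintegral_const_mul _ hv, hint]

/-- For a log-concave function with `f 0 = 1`, squaring loses at most a factor `2ⁿ` of the
integral. -/
theorem IsLogConcave.lintegral_le_two_pow_mul {n : ℕ} {f : Euc n → ℝ≥0∞} (hf : IsLogConcave f)
    (hm : Measurable f) (h0 : f 0 = 1) :
    ∫⁻ x, f x ≤ 2 ^ n * ∫⁻ x, f x * f x := by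
  -- Log-concavity at the midpoint of `x` and `0`; rescaling by `1/2` then costs the Jacobian `2ⁿ`.
  have h1 : ∀ x, f x ≤ f ((1 / 2 : ℝ) • x) * f ((1 / 2 : ℝ) • x) := by
    intro x
    have h := hf x 0 (1 / 2) (1 / 2) (by norm_num) (by norm_num) (by norm_num)
    rw [h0, ENNReal.one_rpow, mul_one, smul_zero, add_zero] at h
    calc f x = f x ^ (1 / 2 : ℝ) * f x ^ (1 / 2 : ℝ) := by
          rw [← ENNReal.rpow_add_of_nonneg _ _ (by norm_num) (by norm_num)]
          norm_num
      _ ≤ _ := by gcongr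
  calc ∫⁻ x, f x ≤ ∫⁻ x, f ((1 / 2 : ℝ) • x) * f ((1 / 2 : ℝ) • x) := lintegral_mono h1
    _ = ∫⁻ x, f x * f x ∂(Measure.map (fun x : Euc n => (1 / 2 : ℝ) • x) volume) :=
        (lintegral_map (hm.mul hm) (measurable_const_smul _)).symm
    _ = 2 ^ n * ∫⁻ x, f x * f x := by
        rw [Measure.map_addHaar_smul _ (by norm_num), lintegral_smul_measure]
        congr 1
        simp [abs_of_pos, ENNReal.ofReal_pow]

/-! ### Gaussians -/

/-- The Gaussian `exp(-b|x|²)`. -/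
noncomputable def gaussianFn (n : ℕ) (b : ℝ) : Euc n → ℝ≥0∞ :=
  fun x => ENNReal.ofReal (Real.exp (-b * ‖x‖ ^ 2))

theorem gaussian_eq (n : ℕ) : gaussian n = gaussianFn n (1 / 2) := rfl

theorem lintegral_gaussianFn (n : ℕ) {b : ℝ} (hb : 0 < b) :
    ∫⁻ x, gaussianFn n b x = ENNReal.ofReal ((Real.pi / b) ^ ((n : ℝ) / 2)) := by
  have h := GaussianFourier.integral_rexp_neg_mul_sq_norm (V := Euc n) hb
  rw [finrank_euclideanSpace_fin] at h
  have hpos : 0 < (Real.pi / b) ^ ((n : ℝ) / 2) := by positivity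
  have hi : Integrable fun v : Euc n => Real.exp (-b * ‖v‖ ^ 2) := by
    by_contra hni
    rw [integral_undef hni] at h
    exact hpos.ne h
  rw [← h, ofReal_integral_eq_lintegral_ofReal hi (ae_of_all _ fun _ => (Real.exp_pos _).le)]
  rfl

theorem continuous_gaussianFn (n : ℕ) (b : ℝ) : Continuous (gaussianFn n b) :=
  ENNReal.continuous_ofReal.comp (by fun_prop)

theorem gaussianFn_zero (n : ℕ) (b : ℝ) : gaussianFn n b 0 = 1 := by simp [gaussianFn]

theorem gaussianFn_neg (n : ℕ) (b : ℝ) (x : Euc n) : gaussianFn n b (-x) = gaussianFn n b x := by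
  simp [gaussianFn]

theorem gaussianFn_le_one (n : ℕ) {b : ℝ} (hb : 0 ≤ b) (x : Euc n) : gaussianFn n b x ≤ 1 := by
  rw [gaussianFn, ENNReal.ofReal_le_one, Real.exp_le_one_iff]
  nlinarith [mul_nonneg hb (sq_nonneg ‖x‖)]

theorem gaussianFn_antitone (n : ℕ) {b c : ℝ} (hbc : b ≤ c) (x : Euc n) :
    gaussianFn n c x ≤ gaussianFn n b x := by
  unfold gaussianFn
  gcongr

theorem isLogConcave_gaussianFn (n : ℕ) {b : ℝ} (hb : 0 ≤ b) : IsLogConcave (gaussianFn n b) := by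
  intro x y s t hs ht hst
  simp only [gaussianFn]
  rw [ENNReal.ofReal_rpow_of_pos (Real.exp_pos _), ENNReal.ofReal_rpow_of_pos (Real.exp_pos _),
    ← ENNReal.ofReal_mul (by positivity), ← Real.exp_mul, ← Real.exp_mul, ← Real.exp_add]
  refine ENNReal.ofReal_le_ofReal (Real.exp_le_exp.2 ?_)
  have hn : ‖s • x + t • y‖ ≤ s * ‖x‖ + t * ‖y‖ := by
    refine (norm_add_le _ _).trans_eq ?_
    rw [norm_smul, norm_smul, Real.norm_of_nonneg hs, Real.norm_of_nonneg ht]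
  have h2 : ‖s • x + t • y‖ ^ 2 ≤ s * ‖x‖ ^ 2 + t * ‖y‖ ^ 2 := by
    have h3 : (s * ‖x‖ + t * ‖y‖) ^ 2 ≤ s * ‖x‖ ^ 2 + t * ‖y‖ ^ 2 := by
      obtain rfl : t = 1 - s := by linarith
      nlinarith [mul_nonneg (mul_nonneg hs ht) (sq_nonneg (‖x‖ - ‖y‖))]
    exact (pow_le_pow_left₀ (norm_nonneg _) hn 2).trans h3
  nlinarith [mul_le_mul_of_nonneg_left h2 hb]

theorem isGeomLogConcave_gaussianFn (n : ℕ) {b : ℝ} (hb : 0 < b) :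
    IsGeomLogConcave (gaussianFn n b) where
  usc := (continuous_gaussianFn n b).upperSemicontinuous
  logConcave := isLogConcave_gaussianFn n hb.le
  le_one := gaussianFn_le_one n hb.le
  map_zero := gaussianFn_zero n b
  lintegral_pos := by
    rw [lintegral_gaussianFn n hb, ENNReal.ofReal_pos]
    have := Real.pi_pos
    positivity
  lintegral_lt_top := by
    rw [lintegral_gaussianFn n hb]
    exact ENNReal.ofReal_lt_top

/-- From `|x|² ≤ 2|z|² + 2|x - z|²` one gets `g₀ ⋆ g₀ ≤ exp(-|x|²/4)`. The right side is expressed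
through `g₀² = exp(-|x|²)` so that it cancels the denominator of the volume bound. -/
theorem lintegral_supConv_gaussian_le (n : ℕ) :
    ∫⁻ x, supConv (gaussian n) (gaussian n) x ≤ 2 ^ n * ∫⁻ x, gaussianFn n 1 x := by
  have h : ∀ x, supConv (gaussian n) (gaussian n) x ≤ gaussianFn n (1 / 4) x := by
    intro x
    refine iSup_le fun z => ?_
    rw [gaussian, gaussian, gaussianFn, ← ENNReal.ofReal_mul (Real.exp_pos _).le, ← Real.exp_add]
    refine ENNReal.ofReal_le_ofReal (Real.exp_le_exp.2 ?_)
    have h1 : ‖x‖ ≤ ‖z‖ + ‖x - z‖ := by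
      simpa using norm_add_le z (x - z)
    have h2 := pow_le_pow_left₀ (norm_nonneg _) h1 2
    nlinarith [sq_nonneg (‖z‖ - ‖x - z‖)]
  refine (lintegral_mono h).trans_eq ?_
  rw [lintegral_gaussianFn n (by norm_num), lintegral_gaussianFn n one_pos]
  have h4 : (Real.pi / (1 / 4)) ^ ((n : ℝ) / 2) = 2 ^ n * (Real.pi / 1) ^ ((n : ℝ) / 2) := by
    rw [show Real.pi / (1 / 4) = 2 ^ (2 : ℝ) * (Real.pi / 1) by norm_num; ring,
      Real.mul_rpow (by positivity) (by positivity), ← Real.rpow_mul (by norm_num),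
      mul_div_cancel₀ _ (by norm_num : (2 : ℝ) ≠ 0), Real.rpow_natCast]
  rw [h4, ENNReal.ofReal_mul (by positivity), ENNReal.ofReal_pow (by norm_num)]
  simp

theorem supConv_gaussian_comp_neg {n : ℕ} (f : Euc n → ℝ≥0∞) (x : Euc n) :
    supConv (gaussian n) (fun y => f (-y)) x = supConv f (gaussian n) (-x) := by
  unfold supConv
  refine (Equiv.subRight x).iSup_congr fun z => ?_
  simp only [Equiv.subRight_apply, neg_sub]
  rw [mul_comm, show -x - (z - x) = -z by abel, gaussian_eq, gaussianFn_neg]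

/-- As `b → ∞`, the sup-convolutions of `f` with the Gaussians `exp(-b|x|²)` converge to `f`. -/
theorem tendsto_supConv_gaussianFn {n : ℕ} {f : Euc n → ℝ≥0∞} (hf : UpperSemicontinuous f)
    (hf1 : ∀ x, f x ≤ 1) (x : Euc n) :
    Tendsto (fun k : ℕ => supConv f (gaussianFn n (k + 1)) x) atTop (𝓝 (f x)) := by
  have hlow : ∀ k : ℕ, f x ≤ supConv f (gaussianFn n (k + 1)) x := fun k =>
    le_supConv_left (gaussianFn_zero _ _) x
  refine tendsto_order.2 ⟨fun a ha => Eventually.of_forall fun k => ha.trans_le (hlow k), ?_⟩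
  intro a ha
  -- Within `δ` of `x`, semicontinuity keeps `f` below `b`; farther away the Gaussian factor is
  -- below `b` for large `k`. The gap `b < a` keeps the inequality strict after the supremum over
  -- `z`.
  obtain ⟨b, hfb, hba⟩ := exists_between ha
  obtain ⟨δ, hδ, hball⟩ := Metric.eventually_nhds_iff.1 (hf x b hfb)
  have hlim : Tendsto (fun k : ℕ => ENNReal.ofReal (Real.exp (-((k : ℝ) + 1) * δ ^ 2))) atTop
      (𝓝 0) := by
    rw [← ENNReal.ofReal_zero]
    refine ENNReal.tendsto_ofReal (Real.tendsto_exp_atBot.comp ?_)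
    refine Tendsto.atBot_mul_const (by positivity) ?_
    exact tendsto_neg_atTop_atBot.comp (tendsto_atTop_add_const_right _ _ tendsto_natCast_atTop_atTop)
  filter_upwards [hlim.eventually_lt_const (bot_le.trans_lt hfb)] with k hk
  refine lt_of_le_of_lt (iSup_le fun z => ?_) hba
  by_cases hz : dist z x < δ
  · calc f z * gaussianFn n (k + 1) (x - z) ≤ f z * 1 := by
          gcongr; exact gaussianFn_le_one n (by positivity) _
      _ ≤ b := by rw [mul_one]; exact (hball hz).le
  · have hd : δ ≤ ‖x - z‖ := by
      rw [← dist_eq_norm, dist_comm]; exact not_lt.1 hz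
    calc f z * gaussianFn n (k + 1) (x - z)
        ≤ 1 * ENNReal.ofReal (Real.exp (-((k : ℝ) + 1) * δ ^ 2)) := by
          gcongr
          · exact hf1 z
          · refine ENNReal.ofReal_le_ofReal (Real.exp_le_exp.2 ?_)
            have := pow_le_pow_left₀ hδ.le hd 2
            have hk0 : (0 : ℝ) ≤ k + 1 := by positivity
            nlinarith [mul_le_mul_of_nonneg_left this hk0]
      _ ≤ b := by rw [one_mul]; exact hk.le

/-! ### The log-Legendre dual -/

/-- Removes `EReal` subtraction: semicontinuity and log-concavity of the dual can then be checked
term by term in the infimum. -/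
theorem logDual_eq_iInf {n : ℕ} (f : Euc n → ℝ≥0∞) (y : Euc n) :
    logDual f y = ⨅ x, (ENNReal.ofReal (Real.exp (inner ℝ x y)) * f x)⁻¹ := by
  unfold logDual legendre
  rw [EReal.exp_neg, ← EReal.expOrderIso_apply, OrderIso.map_iSup, ENNReal.inv_iSup]
  refine iInf_congr fun x => ?_
  rw [EReal.expOrderIso_apply, sub_eq_add_neg, neg_neg, EReal.exp_add, EReal.exp_coe,
    ENNReal.exp_log]

theorem upperSemicontinuous_logDual {n : ℕ} (f : Euc n → ℝ≥0∞) :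
    UpperSemicontinuous (logDual f) := by
  have h : logDual f = fun y => ⨅ x, (ENNReal.ofReal (Real.exp (inner ℝ x y)) * f x)⁻¹ :=
    funext (logDual_eq_iInf f)
  rw [h]
  refine upperSemicontinuous_iInf fun x => Continuous.upperSemicontinuous ?_
  refine continuous_inv.comp ?_
  refine continuous_iff_continuousAt.2 fun y => ?_
  -- As `f x` may be `∞`, continuity of the product rests on the exponential never vanishing.
  refine ENNReal.Tendsto.mul_const 
    ((ENNReal.continuous_ofReal.comp (by fun_prop)).tendsto y) (Or.inl ?_)
  exact (ENNReal.ofReal_pos.2 (Real.exp_pos _)).ne'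

theorem isLogConcave_logDual {n : ℕ} (f : Euc n → ℝ≥0∞) : IsLogConcave (logDual f) := by
  intro x y a b ha hb hab
  rw [logDual_eq_iInf f (a • x + b • y)]
  refine le_iInf fun w => ?_
  have hle : ∀ v, logDual f v ≤ (ENNReal.ofReal (Real.exp (inner ℝ w v)) * f w)⁻¹ := fun v =>
    (logDual_eq_iInf f v).trans_le (iInf_le _ w)
  calc logDual f x ^ a * logDual f y ^ b
      ≤ ((ENNReal.ofReal (Real.exp (inner ℝ w x)) * f w)⁻¹) ^ a *
        ((ENNReal.ofReal (Real.exp (inner ℝ w y)) * f w)⁻¹) ^ b := by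
        gcongr
        · exact hle x
        · exact hle y
    _ = (ENNReal.ofReal (Real.exp (inner ℝ w (a • x + b • y))) * f w)⁻¹ := by
        have hE : ∀ v : Euc n, ENNReal.ofReal (Real.exp (inner ℝ w v)) ≠ 0 := fun v =>
          (ENNReal.ofReal_pos.2 (Real.exp_pos _)).ne'
        have hE' : ∀ v : Euc n, ENNReal.ofReal (Real.exp (inner ℝ w v)) ≠ ∞ := fun v =>
          ENNReal.ofReal_ne_top
        have hexp : ENNReal.ofReal (Real.exp (inner ℝ w (a • x + b • y))) =
            ENNReal.ofReal (Real.exp (inner ℝ w x)) ^ a *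
              ENNReal.ofReal (Real.exp (inner ℝ w y)) ^ b := by
          rw [ENNReal.ofReal_rpow_of_pos (Real.exp_pos _),
            ENNReal.ofReal_rpow_of_pos (Real.exp_pos _), ← ENNReal.ofReal_mul (by positivity),
            ← Real.exp_mul, ← Real.exp_mul, ← Real.exp_add, inner_add_right, inner_smul_right,
            inner_smul_right, mul_comm a, mul_comm b]
        have hinv : ∀ v : Euc n, (ENNReal.ofReal (Real.exp (inner ℝ w v)) * f w)⁻¹ =
            (ENNReal.ofReal (Real.exp (inner ℝ w v)))⁻¹ * (f w)⁻¹ := fun v =>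
          ENNReal.mul_inv (Or.inl (hE v)) (Or.inl (hE' v))
        have hEx : (ENNReal.ofReal (Real.exp (inner ℝ w x)) ^ a) ≠ 0 := by
          simp [hE x, hE' x]
        have hEx' : (ENNReal.ofReal (Real.exp (inner ℝ w x)) ^ a) ≠ ∞ :=
          ENNReal.rpow_ne_top_of_nonneg ha (hE' x)
        rw [hinv, hinv, hinv, hexp, ENNReal.mul_inv (Or.inl hEx) (Or.inl hEx'),
          ENNReal.mul_rpow_of_nonneg _ _ ha, ENNReal.mul_rpow_of_nonneg _ _ hb,
          ENNReal.inv_rpow (ENNReal.ofReal _), ENNReal.inv_rpow (ENNReal.ofReal _),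
          mul_mul_mul_comm, ← ENNReal.rpow_add_of_nonneg _ _ ha hb, hab, ENNReal.rpow_one]

theorem logDual_le_one {n : ℕ} {f : Euc n → ℝ≥0∞} (h0 : f 0 = 1) (y : Euc n) :
    logDual f y ≤ 1 := by
  rw [logDual_eq_iInf]
  refine (iInf_le _ 0).trans ?_
  simp [h0]

theorem logDual_zero {n : ℕ} {f : Euc n → ℝ≥0∞} (h0 : f 0 = 1) (h1 : ∀ x, f x ≤ 1) :
    logDual f 0 = 1 := by
  refine le_antisymm (logDual_le_one h0 0) ?_
  rw [logDual_eq_iInf]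
  refine le_iInf fun x => ?_
  simpa using h1 x

/-! ### Equivalence of the two positions -/

theorem CoveringMPosition.mono {n : ℕ} {f : Euc n → ℝ≥0∞} {C D : ℝ} (hC : 0 ≤ C) (hCD : C ≤ D)
    (h : CoveringMPosition f C) : CoveringMPosition f D := by
  have hle : ENNReal.ofReal (C ^ n) ≤ ENNReal.ofReal (D ^ n) :=
    ENNReal.ofReal_le_ofReal (pow_le_pow_left₀ hC hCD n)
  exact ⟨h.geom, h.lintegral_eq, h.cover_by_gaussian.trans hle, h.cover_gaussian.trans hle,
    h.dual_cover_by_gaussian.trans hle, h.dual_cover_gaussian.trans hle⟩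

/-- Covers by `g₀` give the upper bounds, and covers of `g₀` give the lower bounds once `Cⁿ` is
moved across; the constant is unchanged. -/
theorem CoveringMPosition.volumeMPosition {n : ℕ} {f : Euc n → ℝ≥0∞} {C : ℝ} (hC : 0 < C)
    (hf : CoveringMPosition f C) : VolumeMPosition f C := by
  have hCn : 0 < C ^ n := by positivity
  have hc0 : ENNReal.ofReal (C ^ n) ≠ 0 := (ENNReal.ofReal_pos.2 hCn).ne'
  have hc : ENNReal.ofReal (C ^ n) ≠ ∞ := ENNReal.ofReal_ne_top
  have hlog : IsLogConcave f := hf.geom.logConcave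
  have hlogd := isLogConcave_logDual f
  have hlogg : IsLogConcave (gaussian n) := isLogConcave_gaussianFn n (by norm_num)
  have hswap : ∀ A B : ℝ≥0∞, A ≤ ENNReal.ofReal (C ^ n) * B →
      ENNReal.ofReal (1 / C ^ n) * A ≤ B := by
    intro A B hAB
    rw [one_div, ENNReal.ofReal_inv_of_pos hCn]
    calc _ ≤ (ENNReal.ofReal (C ^ n))⁻¹ * (ENNReal.ofReal (C ^ n) * B) := by gcongr
      _ = B := by rw [← mul_assoc, ENNReal.inv_mul_cancel hc0 hc, one_mul]
  exact
    { geom := hf.geom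
      lintegral_eq := hf.lintegral_eq
      lower := fun h hh => hswap _ _
        (lintegral_supConv_le_mul hlog hh.logConcave hh.le_one hc0 hc hf.cover_gaussian)
      upper := fun h hh =>
        lintegral_supConv_le_mul hlogg hh.logConcave hh.le_one hc0 hc hf.cover_by_gaussian
      dual_lower := fun h hh => hswap _ _
        (lintegral_supConv_le_mul hlogd hh.logConcave hh.le_one hc0 hc hf.dual_cover_gaussian)
      dual_upper := fun h hh =>
        lintegral_supConv_le_mul hlogg hh.logConcave hh.le_one hc0 hc hf.dual_cover_by_gaussian }

/-- If the sup-convolution of `u` with a Gaussian has controlled volume, then `u` is efficiently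
covered by Gaussians. -/
theorem coveringNumber_by_gaussian_le {n : ℕ} {u : Euc n → ℝ≥0∞} (hu : IsLogConcave u)
    (hu1 : ∀ x, u x ≤ 1) {c : ℝ≥0∞}
    (hup : ∫⁻ x, supConv u (gaussian n) x ≤ c * ∫⁻ x, supConv (gaussian n) (gaussian n) x) :
    coveringNumber u (gaussian n) ≤ 2 ^ n * c := by
  have hg1 := isGeomLogConcave_gaussianFn n one_pos
  have h0 := hg1.lintegral_pos.ne'
  have ht := hg1.lintegral_lt_top.ne
  refine (coveringNumber_le_lintegral_supConv hu hu1
    (isLogConcave_gaussianFn n (b := 1 / 2) (by norm_num))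
    (continuous_gaussianFn n (1 / 2)).measurable h0 ht ?_).trans ?_
  · refine lintegral_mono fun s => ?_
    rw [gaussianFn_neg]
    simp only [gaussianFn]
    rw [← ENNReal.ofReal_mul (Real.exp_pos _).le, ← Real.exp_add]
    exact ENNReal.ofReal_le_ofReal (Real.exp_le_exp.2 (by ring_nf; rfl))
  · calc _ ≤ (∫⁻ x, gaussianFn n 1 x)⁻¹ * (c * (2 ^ n * ∫⁻ x, gaussianFn n 1 x)) := by
          gcongr
          refine hup.trans ?_
          gcongr
          exact lintegral_supConv_gaussian_le n
      _ = ((∫⁻ x, gaussianFn n 1 x)⁻¹ * ∫⁻ x, gaussianFn n 1 x) * (2 ^ n * c) := by ring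
      _ = _ := by rw [ENNReal.inv_mul_cancel h0 ht, one_mul]

/-- If moreover the integral of `u` is not too small, then the Gaussian is efficiently covered
by translates of `u`. -/
theorem coveringNumber_gaussian_le {n : ℕ} {u : Euc n → ℝ≥0∞} (hu : IsLogConcave u)
    (hm : Measurable u) (hu0 : u 0 = 1) {c d : ℝ≥0∞} (hd : d ≠ ∞)
    (hup : ∫⁻ x, supConv u (gaussian n) x ≤ c * ∫⁻ x, supConv (gaussian n) (gaussian n) x)
    (hlow : ∫⁻ x, gaussian n x ≤ d * ∫⁻ x, u x) :
    coveringNumber (gaussian n) u ≤ 4 ^ n * c * d := by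
  have hg := isGeomLogConcave_gaussianFn n (b := 1 / 2) (by norm_num)
  set I := ∫⁻ x, gaussian n x with hI
  have hI0 : I ≠ 0 := hg.lintegral_pos.ne'
  have hIt : I ≠ ∞ := hg.lintegral_lt_top.ne
  have hd0 : d ≠ 0 := by
    rintro rfl
    rw [zero_mul] at hlow
    exact hI0 (le_zero_iff.1 hlow)
  have hk0 : 2 ^ n * d ≠ 0 := mul_ne_zero (pow_ne_zero _ two_ne_zero) hd0
  have hkt : 2 ^ n * d ≠ ∞ := ENNReal.mul_ne_top (ENNReal.pow_ne_top ENNReal.ofNat_ne_top) hd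
  -- Lower bound for the denominator with `h = u(-·)`. One factor `2ⁿ` of the final `4ⁿ` arises
  -- here, the other from `g₀ ⋆ g₀`.
  have hsq : (2 ^ n * d)⁻¹ * I ≤ ∫⁻ s, u s * u s := by
    calc (2 ^ n * d)⁻¹ * I ≤ (2 ^ n * d)⁻¹ * (d * (2 ^ n * ∫⁻ s, u s * u s)) := by
          gcongr
          refine hlow.trans ?_
          gcongr
          exact hu.lintegral_le_two_pow_mul hm hu0
      _ = ((2 ^ n * d)⁻¹ * (2 ^ n * d)) * ∫⁻ s, u s * u s := by ring
      _ = _ := by rw [ENNReal.inv_mul_cancel hk0 hkt, one_mul]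
  have hsym : ∫⁻ x, supConv (gaussian n) (fun y => u (-y)) x = ∫⁻ x, supConv u (gaussian n) x := by
    simp_rw [supConv_gaussian_comp_neg]
    exact lintegral_neg_eq_self (supConv u (gaussian n))
  have hg1 : ∫⁻ x, gaussianFn n 1 x ≤ I :=
    lintegral_mono fun x => gaussianFn_antitone n (by norm_num) x
  refine (coveringNumber_le_lintegral_supConv (h := fun y => u (-y)) (c := (2 ^ n * d)⁻¹ * I)
    hg.logConcave hg.le_one hu.comp_neg hm (mul_ne_zero (ENNReal.inv_ne_zero.2 hkt) hI0)
    (ENNReal.mul_ne_top (ENNReal.inv_ne_top.2 hk0) hIt) (by simpa using hsq)).trans ?_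
  rw [ENNReal.mul_inv (Or.inr hIt) (Or.inr hI0), inv_inv]
  calc 2 ^ n * d * I⁻¹ * ∫⁻ x, supConv (gaussian n) (fun y => u (-y)) x
      ≤ 2 ^ n * d * I⁻¹ * (c * (2 ^ n * I)) := by
        gcongr
        rw [hsym]
        refine hup.trans ?_
        gcongr
        exact (lintegral_supConv_gaussian_le n).trans (by gcongr)
    _ = (2 * 2) ^ n * c * d * (I⁻¹ * I) := by rw [mul_pow]; ring
    _ = 4 ^ n * c * d := by rw [ENNReal.inv_mul_cancel hI0 hIt, mul_one]; norm_num

/-- Letting the test function shrink to a point, the dual volume bound gives a lower bound for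
`∫ f*`. -/
theorem VolumeMPosition.lintegral_gaussian_le_dual {n : ℕ} {f : Euc n → ℝ≥0∞} {C : ℝ} (hC : 0 < C)
    (hf : VolumeMPosition f C) :
    ∫⁻ x, gaussian n x ≤ ENNReal.ofReal (C ^ n) * ∫⁻ x, logDual f x := by
  have hCn : 0 < C ^ n := by positivity
  -- `f* ⋆ g₀` serves as the dominating function; the dual upper bound makes it integrable.
  have hfin : ∫⁻ x, supConv (logDual f) (gaussianFn n (1 / 2)) x ≠ ∞ := by
    refine ((hf.dual_upper _ (isGeomLogConcave_gaussianFn n (b := 1 / 2) (by norm_num))).trans_lt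
      (ENNReal.mul_lt_top ENNReal.ofReal_lt_top ?_)).ne
    exact (lintegral_supConv_gaussian_le n).trans_lt (ENNReal.mul_lt_top
      (ENNReal.pow_lt_top ENNReal.ofNat_lt_top)
      (isGeomLogConcave_gaussianFn n one_pos).lintegral_lt_top)
  have hlim : Tendsto (fun k : ℕ => ∫⁻ x, supConv (logDual f) (gaussianFn n (k + 1)) x) atTop
      (𝓝 (∫⁻ x, logDual f x)) := by
    refine tendsto_lintegral_of_dominated_convergence'
      (supConv (logDual f) (gaussianFn n (1 / 2))) (fun k => ?_) (fun k => ?_) hfin ?_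
    · exact (isLogConcave_logDual f).aemeasurable_supConv
        (isLogConcave_gaussianFn n (by positivity))
    · refine ae_of_all _ fun x => iSup_mono fun z => ?_
      gcongr
      refine gaussianFn_antitone n ?_ _
      have : (0 : ℝ) ≤ k := by positivity
      linarith
    · exact ae_of_all _ fun x => tendsto_supConv_gaussianFn (upperSemicontinuous_logDual f)
        (logDual_le_one hf.geom.map_zero) x
  have hk : ∀ k : ℕ, ENNReal.ofReal (1 / C ^ n) * ∫⁻ x, gaussian n x ≤
      ∫⁻ x, supConv (logDual f) (gaussianFn n (k + 1)) x := by
    intro k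
    refine le_trans ?_ (hf.dual_lower _ (isGeomLogConcave_gaussianFn n (by positivity)))
    gcongr with x
    exact le_supConv_left (gaussianFn_zero _ _) x
  have hle := ge_of_tendsto' hlim hk
  calc ∫⁻ x, gaussian n x
      = ENNReal.ofReal (C ^ n) * (ENNReal.ofReal (1 / C ^ n) * ∫⁻ x, gaussian n x) := by
        rw [← mul_assoc, ← ENNReal.ofReal_mul hCn.le, mul_one_div_cancel hCn.ne',
          ENNReal.ofReal_one, one_mul]
    _ ≤ _ := by gcongr

/-- The constant dominates all bounds that occur: `2C` for covering by `g₀`, `4C` for covering `g₀`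
by `f`, and `4C²` for covering `g₀` by `f*`, the extra `C` being the loss in `∫ f*`. -/
theorem VolumeMPosition.coveringMPosition {n : ℕ} {f : Euc n → ℝ≥0∞} {C : ℝ} (hC : 0 < C)
    (hf : VolumeMPosition f C) : CoveringMPosition f (4 * C + 4 * C ^ 2) := by
  have hg := isGeomLogConcave_gaussianFn n (b := 1 / 2) (by norm_num)
  have hint : ∫⁻ x, gaussian n x = ∫⁻ x, f x := by
    rw [hf.lintegral_eq, gaussian_eq, lintegral_gaussianFn n (by norm_num)]
    congr 2
    ring
  have hpow : ∀ D : ℝ, 0 ≤ D → D ≤ 4 * C + 4 * C ^ 2 →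
      ENNReal.ofReal (D ^ n) ≤ ENNReal.ofReal ((4 * C + 4 * C ^ 2) ^ n) := fun D hD hle =>
    ENNReal.ofReal_le_ofReal (pow_le_pow_left₀ hD hle n)
  have h2 : (2 : ℝ≥0∞) ^ n * ENNReal.ofReal (C ^ n) = ENNReal.ofReal ((2 * C) ^ n) := by
    rw [mul_pow, ENNReal.ofReal_mul (by positivity), ENNReal.ofReal_pow (p := 2) (by norm_num)]
    simp
  have h4 : (4 : ℝ≥0∞) ^ n * ENNReal.ofReal (C ^ n) = ENNReal.ofReal ((4 * C) ^ n) := by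
    rw [mul_pow, ENNReal.ofReal_mul (by positivity), ENNReal.ofReal_pow (p := 4) (by norm_num)]
    simp
  have h2le := hpow (2 * C) (by positivity) (by nlinarith [sq_nonneg C])
  have h4le := hpow (4 * C) (by positivity) (by nlinarith [sq_nonneg C])
  have h4le' := hpow (4 * C * C) (by positivity) (by nlinarith)
  have hlogd := isLogConcave_logDual f
  refine ⟨hf.geom, hf.lintegral_eq, ?_, ?_, ?_, ?_⟩
  · exact ((coveringNumber_by_gaussian_le hf.geom.logConcave hf.geom.le_one
      (hf.upper _ hg)).trans_eq h2).trans h2le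
  · refine (coveringNumber_gaussian_le hf.geom.logConcave hf.geom.usc.measurable hf.geom.map_zero
      ENNReal.one_ne_top (hf.upper _ hg) (by rw [one_mul, hint])).trans ?_
    rw [mul_one, h4]
    exact h4le
  · exact ((coveringNumber_by_gaussian_le hlogd (logDual_le_one hf.geom.map_zero)
      (hf.dual_upper _ hg)).trans_eq h2).trans h2le
  · refine (coveringNumber_gaussian_le hlogd (upperSemicontinuous_logDual f).measurable
      (logDual_zero hf.geom.map_zero hf.geom.le_one) ENNReal.ofReal_ne_top (hf.dual_upper _ hg)
      (hf.lintegral_gaussian_le_dual hC)).trans ?_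
    rw [h4, ← ENNReal.ofReal_mul (by positivity), ← mul_pow]
    exact h4le'

end FunctionalCovering

theorem theorem5p5 :
    ∀ C : ℝ, 0 < C → ∃ C₁ : ℝ, 0 < C₁ ∧
      ∀ (n : ℕ) (f : FunctionalCovering.Euc n → ENNReal),
        FunctionalCovering.IsGeomLogConcave f →
          (FunctionalCovering.CoveringMPosition f C → FunctionalCovering.VolumeMPosition f C₁) ∧
          (FunctionalCovering.VolumeMPosition f C → FunctionalCovering.CoveringMPosition f C₁) := by
  intro C hC
  refine ⟨4 * C + 4 * C ^ 2, by positivity, fun n f _ => ⟨fun h => ?_, fun h => ?_⟩⟩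
  · exact (h.mono hC.le (by nlinarith [sq_nonneg C])).volumeMPosition (by positivity)
  · exact h.coveringMPosition hC
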